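/- \textbf{Setting.} Let $d\ge 2$, $n\ge 3$, let $\mathcal H$ be a $d$-dimensional complex Hilbert space, and let $M^{(J)}=(M^{(J)}_i)_{i=1}^m$, $J=1,\dots,N$, be measurements on $\mathcal H$, given by measurement operators with $\sum_i M_i^{(J)\dagger}M_i^{(J)}=\mathbb I$. Let $\mathcal K$ be a finite-dimensional Hilbert space on which operators $\bar M_i^{(J)}$ describe the king's measurements. A pair $(|\Psi\rangle,(P_k)_k)$ of a unit vector and a POVM on $\mathcal K$ \emph{solves the problem} if there is a guess function $(k,J)\mapsto s(k,J)$ such that $\langle \bar M_i^{(J)}\Psi|P_k\bar M_i^{(J)}\Psi\rangle=0$ whenever $s(k,J)\ne i$; that is, Alice, knowing her outcome $k$ and $J$, guesses the king's outcome $i$ with certainty. In the bipartite problem $\mathcal K=\mathcal H\otimes\mathcal H$ and $\bar M_i^{(J)}=\mathbb I\otimes M_i^{(J)}$. In the multipartite problem $\mathcal K=\mathcal H^{\otimes n}$, a factor $l\in\{1,\dots,n\}$ is given to the king, and $\bar M_i^{(J)}=\tilde M_i^{(J)}$, where $\tilde A$ denotes the operator $A$ acting on the $l$-th factor and the identity on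 the others. A family $(E_k)_k$ of operators with $\sum_k E_k^\dagger E_k\le\mathbb I$ is called an error. A subspace $C$ of dimension $g$ of a $D$-dimensional Hilbert space is a $(D,g)$ quantum error-correcting code against $(E_k)_k$ if there is a trace-preserving completely positive map $R$ such that, for every density operator $\rho$ on $C$, $R(\sum_kE_k\rho E_k^\dagger)$ is a positive multiple of $\rho$. A code state is a unit vector in $C$. Let $\{|\psi_j\rangle\}_{j=0}^{d-1}$ and $\{|\phi_j\rangle\}_{j=0}^{d-1}$ be orthonormal bases of $\mathcal H$, let $\eta_j>0$ with $\sum_j\eta_j^2=1$, let $|\Psi_{\boldsymbol\eta}\rangle=\sum_j\eta_j|\psi_j\rangle\otimes|\phi_j\rangle$, and let $\mathcal P=(|p_k\rangle\langle p_k|)_{k=1}^{d^2}$ for an orthonormal basis $\{|p_k\rangle\}$ of $\mathcal H\otimes\mathcal H$. For $i_1,\dots,i_n\in\{0,\dots,d-1\}$ let $$|\Psi_{\boldsymbol\eta,i_1,\dots,i_n}\rangle=\sum_{j=0}^{d-1}\eta_j\,|\phi_{j\oplus i_1}\rangle\otimes\cdots\otimes|\phi_{j\oplus i_n}\rangle,$$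 where $\oplus$ is addition modulo $d$ (generalized GHZ states). \textbf{Theorem.} Suppose that $(|\Psi_{\boldsymbol\eta}\rangle,\mathcal P)$ solves the bipartite problem, and let $l\in\{1,\dots,n\}$. Then there are an error $(L_k)_{k=1}^{d^2}$ on $\mathcal H$, index sets $X^{(J,i)}\subset\{1,\dots,d^2\}$, coefficients $f^{(J,i)}_k\in\mathbb C$ and $\alpha>0$ such that $$X^{(J,i)}\cap X^{(J,i')}=\emptyset\ (i\ne i'),\qquad M_i^{(J)}=\sum_{k\in X^{(J,i)}}f_k^{(J,i)}L_k,\qquad \langle(\mathbb I\otimes L_k)\Psi_{\boldsymbol\eta}|(\mathbb I\otimes L_{k'})\Psi_{\boldsymbol\eta}\rangle=\frac{\alpha}{d}\,\delta_{kk'}.\qquad(*)$$ For all $(L_k)_k$, $X^{(J,i)}$, $f_k^{(J,i)}$, $\alpha$ as in $(*)$, call a set $\tilde S$ of states $|\Psi_{\boldsymbol\eta,i_1,\dots,i_n}\rangle$ with $\eta_{j\oplus i_l}=\eta_j$ for all $j$ (for example $i_l=0$, or $i_l$ arbitrary if all $\eta_j$ are equal) \emph{admissible} if $\langle\tilde L_k\Phi|\tilde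 L_{k'}\Phi'\rangle=0$ for all $k,k'$ and all distinct $\Phi,\Phi'\in\tilde S$. Then: (i) there is an admissible set with at least $2$ elements; (ii) for every admissible set $\tilde S$ with $g$ elements, $\tilde C=\operatorname{span}\tilde S$ is a $(d^n,g)$ quantum error-correcting code against the error $(\tilde L_k)_k$, and for every code state $|\Psi\rangle\in\tilde C$ the pair of $|\Psi\rangle$ and the measurement formed by the orthogonal projections onto the subspaces $\tilde L_k\tilde C$, $k=1,\dots,d^2$, together with $\mathbb I$ minus their sum, solves the multipartite problem. -/

import Mathlib

open scoped Kronecker ComplexOrder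

/-! Finite-dimensional quantum systems are written in coordinates: a system with index set `s` is
`EuclideanSpace ℂ s`, operators on it are matrices, a `d`-dimensional system `H` is indexed by
`Fin d`, the bipartite system `H ⊗ H` by `Fin d × Fin d` and `H^{⊗ n}` by `Fin n → Fin d`. -/

namespace MeanKing

/-- The action of an operator on a vector. -/
noncomputable def act {s : Type*} [Fintype s] [DecidableEq s] (A : Matrix s s ℂ)
    (v : EuclideanSpace ℂ s) : EuclideanSpace ℂ s :=
  Matrix.toEuclideanLin A v

/-- A measurement described by measurement operators `M_i`: `∑ i, M_i† M_i = 1`. -/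
def IsMeasurement {s ι : Type*} [Fintype s] [DecidableEq s] [Fintype ι]
    (M : ι → Matrix s s ℂ) : Prop :=
  ∑ i, (M i).conjTranspose * M i = 1

/-- A POVM: positive semidefinite operators that sum to the identity. -/
def IsPOVM {s κ : Type*} [Fintype s] [DecidableEq s] [Fintype κ]
    (P : κ → Matrix s s ℂ) : Prop :=
  (∀ k, (P k).PosSemidef) ∧ ∑ k, P k = 1

/-- The joint probability that the king, measuring with measurement operator `A` on the initial
state `Ψ`, obtains the outcome of `A`, and that afterwards Alice obtains the outcome of the POVM
element `B`: `⟨A Ψ | B A Ψ⟩`. -/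
noncomputable def jointProb {s : Type*} [Fintype s] [DecidableEq s] (A B : Matrix s s ℂ)
    (Ψ : EuclideanSpace ℂ s) : ℂ :=
  inner ℂ (act A Ψ) (act B (act A Ψ))

/-- The pair of the initial state `Ψ` and Alice's POVM `P` solves the mean king's problem for the
king's measurements `M J = (M J i)_i` (operators on the whole system): from her outcome `k` and the
measurement type `J`, Alice has a guess that equals the king's outcome with certainty. -/
def IsSolution {s κ : Type*} [Fintype s] [DecidableEq s] [Fintype κ] {N m : ℕ}
    (M : Fin N → Fin m → Matrix s s ℂ) (Ψ : EuclideanSpace ℂ s) (P : κ → Matrix s s ℂ) : Prop :=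
  ‖Ψ‖ = 1 ∧ IsPOVM P ∧
    ∃ guess : κ → Fin N → Fin m,
      ∀ (J : Fin N) (i : Fin m) (k : κ), guess k J ≠ i → jointProb (M J i) (P k) Ψ = 0

/-- An error: operators `E_k` with `∑ k, E_k† E_k ≤ 1`, the Kraus operators of a trace
nonincreasing completely positive map. -/
def IsError {s κ : Type*} [Fintype s] [DecidableEq s] [Fintype κ]
    (E : κ → Matrix s s ℂ) : Prop :=
  (1 - ∑ k, (E k).conjTranspose * E k).PosSemidef

/-- The completely positive map with Kraus operators `E_k`: `ρ ↦ ∑ k, E_k ρ E_k†`. -/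
def krausMap {s κ : Type*} [Fintype s] [Fintype κ]
    (E : κ → Matrix s s ℂ) (ρ : Matrix s s ℂ) : Matrix s s ℂ :=
  ∑ k, E k * ρ * (E k).conjTranspose

/-- `ρ` is a density operator on the subspace `C`. -/
def IsDensityOn {s : Type*} [Fintype s] [DecidableEq s]
    (C : Submodule ℂ (EuclideanSpace ℂ s)) (ρ : Matrix s s ℂ) : Prop :=
  ρ.PosSemidef ∧ ρ.trace = 1 ∧ ∀ v, act ρ v ∈ C

/-- `C` is a `(D, g)` quantum error-correcting code against the error `(E_k)_k`: a `g`-dimensional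
subspace of a `D`-dimensional space with a recovery, that is, a trace-preserving completely positive
map (with Kraus operators `R_a`, `∑ a, R_a† R_a = 1`) that returns every density operator on `C`,
after the error, to a positive multiple of itself. -/
def IsQECC {s κ : Type*} [Fintype s] [DecidableEq s] [Fintype κ] (D g : ℕ)
    (C : Submodule ℂ (EuclideanSpace ℂ s)) (E : κ → Matrix s s ℂ) : Prop :=
  Module.finrank ℂ (EuclideanSpace ℂ s) = D ∧ Module.finrank ℂ C = g ∧ IsError E ∧
    ∃ (r : ℕ) (R : Fin r → Matrix s s ℂ),
      ∑ a, (R a).conjTranspose * R a = 1 ∧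
      ∀ ρ, IsDensityOn C ρ → ∃ c : ℝ, 0 < c ∧ krausMap R (krausMap E ρ) = (c : ℂ) • ρ

/-! ### The bipartite system -/

/-- The bipartite state `∑ j, η_j ψ_j ⊗ φ_j`. -/
noncomputable def schmidtState {d : ℕ} (η : Fin d → ℝ)
    (ψ φ : OrthonormalBasis (Fin d) ℂ (EuclideanSpace ℂ (Fin d))) :
    EuclideanSpace ℂ (Fin d × Fin d) :=
  ∑ j, (η j : ℂ) • WithLp.toLp 2 (fun x : Fin d × Fin d => ψ j x.1 * φ j x.2)

/-- The operator `1 ⊗ A` on the bipartite system. -/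
def onKing {d : ℕ} (A : Matrix (Fin d) (Fin d) ℂ) : Matrix (Fin d × Fin d) (Fin d × Fin d) ℂ :=
  (1 : Matrix (Fin d) (Fin d) ℂ) ⊗ₖ A

/-- The rank-one operator `|v⟩⟨v|`. -/
def ketbra {s : Type*} (v : EuclideanSpace ℂ s) : Matrix s s ℂ :=
  Matrix.of fun x y => v x * star (v y)

/-- A quantum operation `(L_k)_k` on the king's system with index sets `X J i`, coefficients
`f J i k` and a constant `α > 0` such that, for each `J`, the sets `X J i` are disjoint,
`M J i = ∑ k ∈ X J i, f J i k • L k`, and the vectors `(1 ⊗ L_k) Ψ` are orthogonal with squared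
norm `α / d`. -/
structure IsKingError {d N m : ℕ} (M : Fin N → Fin m → Matrix (Fin d) (Fin d) ℂ)
    (Ψ : EuclideanSpace ℂ (Fin d × Fin d)) (L : Fin (d ^ 2) → Matrix (Fin d) (Fin d) ℂ)
    (X : Fin N → Fin m → Finset (Fin (d ^ 2))) (f : Fin N → Fin m → Fin (d ^ 2) → ℂ)
    (α : ℝ) : Prop where
  isError : IsError L
  disjoint : ∀ J i i', i ≠ i' → Disjoint (X J i) (X J i')
  decomposition : ∀ J i, M J i = ∑ k ∈ X J i, f J i k • L k
  alpha_pos : 0 < α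
  orthogonal : ∀ k k', inner ℂ (act (onKing (L k)) Ψ) (act (onKing (L k')) Ψ) =
    if k = k' then ((α / d : ℝ) : ℂ) else 0

/-! ### The multipartite system -/

/-- The product vector `v_1 ⊗ ⋯ ⊗ v_n`. -/
noncomputable def tensorVec {d n : ℕ} (v : Fin n → EuclideanSpace ℂ (Fin d)) :
    EuclideanSpace ℂ (Fin n → Fin d) :=
  WithLp.toLp 2 (fun x => ∏ u, v u (x u))

/-- The product operator `B_1 ⊗ ⋯ ⊗ B_n`. -/
def tensorOp {d n : ℕ} (B : Fin n → Matrix (Fin d) (Fin d) ℂ) :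
    Matrix (Fin n → Fin d) (Fin n → Fin d) ℂ :=
  Matrix.of fun x y => ∏ u, B u (x u) (y u)

/-- The operator `1 ⊗ ⋯ ⊗ 1 ⊗ A ⊗ 1 ⊗ ⋯ ⊗ 1` with `A` on the `l`-th factor. -/
def onFactor {d n : ℕ} (l : Fin n) (A : Matrix (Fin d) (Fin d) ℂ) :
    Matrix (Fin n → Fin d) (Fin n → Fin d) ℂ :=
  tensorOp (Function.update (fun _ => 1) l A)

/-- The generalized GHZ state `∑ j, η_j φ_{j ⊕ i_1} ⊗ ⋯ ⊗ φ_{j ⊕ i_n}`. The sum in `Fin d` is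
addition modulo `d`. -/
noncomputable def ghzState {d n : ℕ} (η : Fin d → ℝ)
    (φ : OrthonormalBasis (Fin d) ℂ (EuclideanSpace ℂ (Fin d))) (i : Fin n → Fin d) :
    EuclideanSpace ℂ (Fin n → Fin d) :=
  ∑ j, (η j : ℂ) • tensorVec (fun u => φ (j + i u))

/-- A finite set of generalized GHZ states whose mutual cross inner products under the operators
`L_k` on the `l`-th factor vanish. The shift `i_l` on the king's factor has to leave `η`
invariant (for example `i_l = 0`; any `i_l` if all `η_j` are equal). -/
def IsGHZFamily {d n : ℕ} (l : Fin n) (η : Fin d → ℝ)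
    (φ : OrthonormalBasis (Fin d) ℂ (EuclideanSpace ℂ (Fin d)))
    (L : Fin (d ^ 2) → Matrix (Fin d) (Fin d) ℂ)
    (S : Finset (EuclideanSpace ℂ (Fin n → Fin d))) : Prop :=
  (∀ Φ ∈ S, ∃ i : Fin n → Fin d, (∀ j, η (j + i l) = η j) ∧ Φ = ghzState η φ i) ∧
  ∀ Φ ∈ S, ∀ Φ' ∈ S, Φ ≠ Φ' →
    ∀ k k', inner ℂ (act (onFactor l (L k)) Φ) (act (onFactor l (L k')) Φ') = 0

/-- The code spanned by `S`. -/
def code {s : Type*} (S : Finset (EuclideanSpace ℂ s)) : Submodule ℂ (EuclideanSpace ℂ s) :=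
  Submodule.span ℂ (S : Set (EuclideanSpace ℂ s))

/-- Alice's measurement that corresponds to the code `C` and the errors `E_k`: the element with
index `some k` is the orthogonal projection onto `E_k C`, and the element with index `none` is the
identity minus the sum of these projections. -/
noncomputable def discriminator {s κ : Type*} [Fintype s] [DecidableEq s] [Fintype κ]
    (C : Submodule ℂ (EuclideanSpace ℂ s)) (E : κ → Matrix s s ℂ) : Option κ → Matrix s s ℂ :=
  let Q : κ → Matrix s s ℂ := fun k =>
    Matrix.toEuclideanLin.symm
      ((C.map (Matrix.toEuclideanLin (E k))).starProjection :
        EuclideanSpace ℂ s →ₗ[ℂ] EuclideanSpace ℂ s)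
  fun o => o.elim (1 - ∑ k, Q k) Q

end MeanKing

/-! As all `η j` are positive, `A ↦ (1 ⊗ A) Ψ_η` is a linear isomorphism from operators on `H` onto
`H ⊗ H`. The error is the preimage of Alice's basis `p`, scaled down until `∑ L_k† L_k ≤ 1`.
Expanding `(1 ⊗ M J i) Ψ_η` in `p`, certainty of the guess removes every `p k` with `guess k J ≠ i`;
pulling back writes `M J i` in the `L k` with `guess k J = i` (`exists_isKingError`).

In a GHZ state any factor other than the `l`-th already records `j`, so operators on factor `l` have
the same inner products as in the bipartite state (`inner_onFactor_ghzState_self`). With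
admissibility this gives the Knill-Laflamme condition `⟨E_k x, E_k' y⟩ = (α / d) δ_kk' ⟨x, y⟩` on
the code, which is `SplitsCode`.

Both conclusions follow from it. The subspaces `E_k C` are orthogonal and each `E_k` is a scaled
isometry on `C`, so measuring `k` and undoing `E_k` recovers the state. The king's outcome `i`
leaves the state in the sum of the `E_k C` with `k ∈ X J i`, and disjointness lets `k` reveal `i`. A
third factor leaves room to shift one factor and keep another fixed, whence an admissible pair. -/

namespace MeanKing

/-! ### Matrices acting on vectors -/

section Act

lemma posSemidef_of_isHermitian_of_mul_self {s : Type*} [Fintype s] {Q : Matrix s s ℂ} (h : Q.IsHermitian)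
    (hQ : Q * Q = Q) : Q.PosSemidef := by
  have := Matrix.posSemidef_self_mul_conjTranspose Q
  rwa [h.eq, hQ] at this
variable {s κ : Type*} [Fintype s] [DecidableEq s]

lemma act_one (v : EuclideanSpace ℂ s) : act 1 v = v := by simp [act]

lemma act_mul (A B : Matrix s s ℂ) (v : EuclideanSpace ℂ s) : act (A * B) v = act A (act B v) := by
  simp [act]

lemma act_smul (c : ℂ) (A : Matrix s s ℂ) (v : EuclideanSpace ℂ s) :
    act (c • A) v = c • act A v := by simp only [act, map_smul, LinearMap.smul_apply]

lemma act_sub (A B : Matrix s s ℂ) (v : EuclideanSpace ℂ s) :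
    act (A - B) v = act A v - act B v := by simp only [act, map_sub, LinearMap.sub_apply]

lemma act_sum (t : Finset κ) (A : κ → Matrix s s ℂ) (v : EuclideanSpace ℂ s) :
    act (∑ k ∈ t, A k) v = ∑ k ∈ t, act (A k) v := by
  simp only [act, map_sum, LinearMap.sum_apply]

lemma act_zero_left (v : EuclideanSpace ℂ s) : act 0 v = 0 := by simp [act]

lemma act_vec_zero (A : Matrix s s ℂ) : act A 0 = 0 := by simp [act]

lemma act_vec_smul (A : Matrix s s ℂ) (c : ℂ) (v : EuclideanSpace ℂ s) :
    act A (c • v) = c • act A v := by simp only [act, map_smul]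

lemma act_vec_sum (A : Matrix s s ℂ) (t : Finset κ) (v : κ → EuclideanSpace ℂ s) :
    act A (∑ k ∈ t, v k) = ∑ k ∈ t, act A (v k) := by
  simp only [act, map_sum]

lemma act_ext {A B : Matrix s s ℂ} (h : ∀ v, act A v = act B v) : A = B :=
  Matrix.toEuclideanLin.injective (LinearMap.ext h)

lemma inner_act_left (A : Matrix s s ℂ) (v w : EuclideanSpace ℂ s) :
    inner ℂ (act A v) w = inner ℂ v (act A.conjTranspose w) := by
  rw [act, act, Matrix.toEuclideanLin_conjTranspose_eq_adjoint, LinearMap.adjoint_inner_right]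

lemma inner_act_right (A : Matrix s s ℂ) (v w : EuclideanSpace ℂ s) :
    inner ℂ v (act A w) = inner ℂ (act A.conjTranspose v) w := by
  rw [inner_act_left, Matrix.conjTranspose_conjTranspose]

lemma act_apply (A : Matrix s s ℂ) (v : EuclideanSpace ℂ s) (x : s) :
    act A v x = ∑ y, A x y * v y := rfl

end Act

/-! ### Recovery and discrimination from the Knill-Laflamme condition -/

section Code

variable {s κ : Type*} [Fintype s] [DecidableEq s]

/-- The matrix of the orthogonal projection onto a subspace. -/
noncomputable def projMatrix (C : Submodule ℂ (EuclideanSpace ℂ s)) : Matrix s s ℂ :=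
  Matrix.toEuclideanLin.symm (C.starProjection : EuclideanSpace ℂ s →ₗ[ℂ] EuclideanSpace ℂ s)

lemma act_projMatrix (C : Submodule ℂ (EuclideanSpace ℂ s)) (v : EuclideanSpace ℂ s) :
    act (projMatrix C) v = C.starProjection v := by
  simp [act, projMatrix]

lemma act_projMatrix_of_mem {C : Submodule ℂ (EuclideanSpace ℂ s)} {v : EuclideanSpace ℂ s}
    (hv : v ∈ C) : act (projMatrix C) v = v := by
  rw [act_projMatrix, Submodule.starProjection_eq_self_iff.2 hv]

lemma act_projMatrix_mem (C : Submodule ℂ (EuclideanSpace ℂ s)) (v : EuclideanSpace ℂ s) :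
    act (projMatrix C) v ∈ C := by
  rw [act_projMatrix]; exact Submodule.starProjection_apply_mem C v

lemma conjTranspose_projMatrix (C : Submodule ℂ (EuclideanSpace ℂ s)) :
    (projMatrix C).conjTranspose = projMatrix C := by
  refine act_ext fun v => ext_inner_right ℂ fun w => ?_
  rw [inner_act_left, Matrix.conjTranspose_conjTranspose, act_projMatrix, act_projMatrix,
    Submodule.inner_starProjection_left_eq_right]

lemma projMatrix_mul_self (C : Submodule ℂ (EuclideanSpace ℂ s)) :
    projMatrix C * projMatrix C = projMatrix C :=
  act_ext fun v => by rw [act_mul, act_projMatrix_of_mem (act_projMatrix_mem C v)]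

/-- The projection onto `E_k C`, written with the operator `E_k`. -/
noncomputable def branch (C : Submodule ℂ (EuclideanSpace ℂ s)) (E : κ → Matrix s s ℂ) (a : ℝ)
    (k : κ) : Matrix s s ℂ :=
  ((a : ℂ)⁻¹) • (E k * projMatrix C * (projMatrix C * (E k).conjTranspose))

lemma conjTranspose_branch (C : Submodule ℂ (EuclideanSpace ℂ s)) (E : κ → Matrix s s ℂ)
    (a : ℝ) (k : κ) :
    (branch C E a k).conjTranspose = branch C E a k := by
  simp [branch, conjTranspose_projMatrix, Matrix.mul_assoc]

/-- The operators `E_k` act on `C` as `√a` times isometries with mutually orthogonal ranges. -/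
def SplitsCode [DecidableEq κ] (C : Submodule ℂ (EuclideanSpace ℂ s)) (E : κ → Matrix s s ℂ)
    (a : ℝ) : Prop :=
  0 < a ∧ ∀ k k', ∀ x ∈ C, ∀ y ∈ C,
    inner ℂ (act (E k) x) (act (E k') y) = if k = k' then (a : ℂ) * inner ℂ x y else 0

variable [DecidableEq κ] {C : Submodule ℂ (EuclideanSpace ℂ s)} {E : κ → Matrix s s ℂ} {a : ℝ}

/-- The Knill-Laflamme condition in operator form; every later product is contracted with it. -/
lemma SplitsCode.projMatrix_mul (h : SplitsCode C E a) (k k' : κ) :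
    projMatrix C * (E k).conjTranspose * (E k' * projMatrix C) =
      if k = k' then (a : ℂ) • projMatrix C else 0 := by
  refine act_ext fun v => ext_inner_left ℂ fun w => ?_
  have := h.2 k k' _ (act_projMatrix_mem C w) _ (act_projMatrix_mem C v)
  simp only [act_mul]
  rw [inner_act_right, conjTranspose_projMatrix, inner_act_right,
    Matrix.conjTranspose_conjTranspose, this]
  split_ifs
  · rw [act_smul, inner_smul_right, inner_act_left, conjTranspose_projMatrix, ← act_mul,
      projMatrix_mul_self]
  · simp [act_zero_left]

lemma SplitsCode.branch_mul (h : SplitsCode C E a) (k k' : κ) :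
    branch C E a k * branch C E a k' = if k = k' then branch C E a k else 0 := by
  have ha : (a : ℂ) ≠ 0 := by exact_mod_cast h.1.ne'
  have e : branch C E a k * branch C E a k' = ((a : ℂ)⁻¹ * (a : ℂ)⁻¹) •
      (E k * projMatrix C * (projMatrix C * (E k).conjTranspose * (E k' * projMatrix C)) *
        (projMatrix C * (E k').conjTranspose)) := by
    simp only [branch, smul_mul_assoc, mul_smul_comm, smul_smul, Matrix.mul_assoc]
  rw [e, h.projMatrix_mul]
  split_ifs with hk
  · subst hk
    rw [Matrix.mul_smul, Matrix.smul_mul, smul_smul, branch, Matrix.mul_assoc (E k),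
      projMatrix_mul_self]
    congr 1
    field_simp
  · simp

lemma SplitsCode.branch_mul_act (h : SplitsCode C E a) (k k' : κ) :
    branch C E a k * (E k' * projMatrix C) = if k = k' then E k' * projMatrix C else 0 := by
  have ha : (a : ℂ) ≠ 0 := by exact_mod_cast h.1.ne'
  rw [branch, Matrix.smul_mul, Matrix.mul_assoc _ _ (E k' * projMatrix C), h.projMatrix_mul]
  split_ifs with hk
  · subst hk
    rw [Matrix.mul_smul, smul_smul, inv_mul_cancel₀ ha, one_smul, Matrix.mul_assoc,
      projMatrix_mul_self]
  · simp

/-- `branch` has values in `E_k C`, fixes `E_k C` pointwise and is self-adjoint; these properties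
characterize the orthogonal projection. -/
lemma SplitsCode.projMatrix_map (h : SplitsCode C E a) (k : κ) :
    projMatrix (C.map (Matrix.toEuclideanLin (E k))) = branch C E a k := by
  refine act_ext fun v => ?_
  rw [act_projMatrix]
  refine Submodule.eq_starProjection_of_mem_of_inner_eq_zero ?_ ?_
  · rw [branch, Matrix.mul_assoc, act_smul, act_mul, act_mul]
    exact Submodule.smul_mem _ _ (Submodule.mem_map_of_mem (act_projMatrix_mem C _))
  · rintro _ ⟨x, hx, rfl⟩
    have : act (branch C E a k) (act (E k) x) = act (E k) x := by
      have := congrArg (fun A => act A x) (h.branch_mul_act k k)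
      simpa only [act_mul, act_projMatrix_of_mem hx, if_pos] using this
    rw [inner_sub_left, inner_act_left, conjTranspose_branch]
    exact sub_eq_zero.2 (congrArg (inner ℂ v) this.symm)

variable [Fintype κ]

/-- The projection onto the orthogonal complement of all the subspaces `E_k C`. -/
noncomputable def rest (C : Submodule ℂ (EuclideanSpace ℂ s)) (E : κ → Matrix s s ℂ) (a : ℝ) :
    Matrix s s ℂ :=
  1 - ∑ k, branch C E a k

lemma conjTranspose_rest {κ : Type*} [Fintype κ] (C : Submodule ℂ (EuclideanSpace ℂ s))
    (E : κ → Matrix s s ℂ) (a : ℝ) : (rest C E a).conjTranspose = rest C E a := by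
  simp [rest, Matrix.conjTranspose_sum, conjTranspose_branch]

lemma SplitsCode.rest_mul_act (h : SplitsCode C E a) (k : κ) :
    rest C E a * (E k * projMatrix C) = 0 := by
  simp [rest, Matrix.sub_mul, Finset.sum_mul, h.branch_mul_act]

lemma SplitsCode.rest_mul_self (h : SplitsCode C E a) :
    rest C E a * rest C E a = rest C E a := by
  have : (∑ k, branch C E a k) * ∑ k, branch C E a k = ∑ k, branch C E a k := by
    simp [Finset.sum_mul, Finset.mul_sum, h.branch_mul]
  simp only [rest, Matrix.sub_mul, Matrix.mul_sub, this]
  simp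

lemma SplitsCode.discriminator_some (h : SplitsCode C E a) (k : κ) :
    discriminator C E (some k) = branch C E a k := h.projMatrix_map k

lemma SplitsCode.discriminator_none (h : SplitsCode C E a) :
    discriminator C E none = rest C E a :=
  congrArg (1 - ·) (Finset.sum_congr rfl fun k _ => h.projMatrix_map k)

lemma SplitsCode.isPOVM_discriminator (h : SplitsCode C E a) : IsPOVM (discriminator C E) := by
  constructor
  · rintro (_ | k)
    · rw [h.discriminator_none]
      exact posSemidef_of_isHermitian_of_mul_self (conjTranspose_rest C E a) h.rest_mul_self
    · rw [h.discriminator_some]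
      exact posSemidef_of_isHermitian_of_mul_self (conjTranspose_branch C E a k) (by simp [h.branch_mul])
  · rw [Fintype.sum_option]
    simp only [h.discriminator_some, h.discriminator_none, rest]
    abel

lemma mul_of_isDensityOn {ρ : Matrix s s ℂ} (hρ : IsDensityOn C ρ) :
    projMatrix C * ρ * projMatrix C = ρ := by
  have h1 : projMatrix C * ρ = ρ := act_ext fun v => by
    rw [act_mul, act_projMatrix_of_mem (hρ.2.2 v)]
  have h2 : ρ * projMatrix C = ρ := by
    have := congrArg Matrix.conjTranspose h1
    rwa [Matrix.conjTranspose_mul, conjTranspose_projMatrix, hρ.1.isHermitian.eq] at this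
  rw [h1, h2]

/-- The recovery: outcome `some k` undoes `E_k`. -/
noncomputable def recovery (C : Submodule ℂ (EuclideanSpace ℂ s)) (E : κ → Matrix s s ℂ) (a : ℝ) :
    Option κ → Matrix s s ℂ :=
  fun o => o.elim (rest C E a)
    fun k => (((√a)⁻¹ : ℝ) : ℂ) • (projMatrix C * (E k).conjTranspose)

lemma SplitsCode.sum_recovery (h : SplitsCode C E a) :
    ∑ o, (recovery C E a o).conjTranspose * recovery C E a o = 1 := by
  have hs : (((√a)⁻¹ : ℝ) : ℂ) * (((√a)⁻¹ : ℝ) : ℂ) = (a : ℂ)⁻¹ := by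
    rw [← Complex.ofReal_mul, ← mul_inv, Real.mul_self_sqrt h.1.le, Complex.ofReal_inv]
  have hk (k : κ) : (recovery C E a (some k)).conjTranspose * recovery C E a (some k) =
      branch C E a k := by
    simp only [recovery, Option.elim, Matrix.conjTranspose_smul, Matrix.conjTranspose_mul,
      Matrix.conjTranspose_conjTranspose, conjTranspose_projMatrix, Matrix.smul_mul,
      Matrix.mul_smul, smul_smul, branch, RCLike.star_def, Complex.conj_ofReal, hs]
  rw [Fintype.sum_option]
  simp only [hk]
  simp only [recovery, Option.elim, conjTranspose_rest, h.rest_mul_self]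
  simp [rest]

/-- Only the recovery outcome `some k` responds to `E_k`, and there the product is `√a` times the
projection. Each `k` thus contributes `a • ρ`. -/
lemma SplitsCode.krausMap_recovery (h : SplitsCode C E a) {ρ : Matrix s s ℂ}
    (hρ : IsDensityOn C ρ) :
    krausMap (recovery C E a) (krausMap E ρ) = ((Fintype.card κ * a : ℝ) : ℂ) • ρ := by
  have hsa : (((√a)⁻¹ : ℝ) : ℂ) * a = ((√a : ℝ) : ℂ) := by
    rw [← Complex.ofReal_mul, inv_mul_eq_div, Real.div_sqrt]
  have hss : ((√a : ℝ) : ℂ) * ((√a : ℝ) : ℂ) = a := by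
    rw [← Complex.ofReal_mul, Real.mul_self_sqrt h.1.le]
  have hR (o : Option κ) (k : κ) : recovery C E a o * (E k * projMatrix C) =
      if o = some k then ((√a : ℝ) : ℂ) • projMatrix C else 0 := by
    rcases o with _ | k'
    · simpa [recovery] using h.rest_mul_act k
    · simp only [recovery, Option.elim, Matrix.smul_mul, h.projMatrix_mul, Option.some.injEq]
      split_ifs
      · rw [smul_smul, hsa]
      · simp
  have hterm (o : Option κ) (k : κ) :
      recovery C E a o * (E k * ρ * (E k).conjTranspose) * (recovery C E a o).conjTranspose =
        if o = some k then (a : ℂ) • ρ else 0 := by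
    have e : recovery C E a o * (E k * ρ * (E k).conjTranspose) * (recovery C E a o).conjTranspose =
        (recovery C E a o * (E k * projMatrix C)) * ρ *
          (recovery C E a o * (E k * projMatrix C)).conjTranspose := by
      -- Since `ρ` lives on `C`, a projection can be inserted on each side of it.
      conv_lhs => rw [← mul_of_isDensityOn hρ]
      simp only [Matrix.conjTranspose_mul, conjTranspose_projMatrix, Matrix.mul_assoc]
    rw [e, hR]
    split_ifs
    · rw [Matrix.conjTranspose_smul, conjTranspose_projMatrix, Matrix.smul_mul, Matrix.smul_mul,
        Matrix.mul_smul, smul_smul, mul_of_isDensityOn hρ, RCLike.star_def, Complex.conj_ofReal, hss]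
    · simp
  simp only [krausMap, Finset.mul_sum, Finset.sum_mul, hterm]
  rw [Finset.sum_comm]
  simp [mul_smul, ← Nat.cast_smul_eq_nsmul ℂ]

lemma SplitsCode.isQECC [Nonempty κ] (h : SplitsCode C E a) (hE : IsError E) :
    IsQECC (Fintype.card s) (Module.finrank ℂ C) C E := by
  let e := Fintype.equivFin (Option κ)
  refine ⟨by simp, rfl, hE, Fintype.card (Option κ), recovery C E a ∘ e.symm, ?_, ?_⟩
  · rw [← h.sum_recovery]
    exact e.symm.sum_comp fun o => (recovery C E a o).conjTranspose * recovery C E a o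
  · intro ρ hρ
    refine ⟨Fintype.card κ * a, mul_pos (by exact_mod_cast Fintype.card_pos) h.1, ?_⟩
    rw [← h.krausMap_recovery hρ]
    exact e.symm.sum_comp fun o =>
      recovery C E a o * krausMap E ρ * (recovery C E a o).conjTranspose

/-- After outcome `i` the state is a combination of vectors in `E_k C` with `k ∈ X J i`, and all
other elements of the measurement annihilate it. -/
lemma SplitsCode.isSolution {N m : ℕ} (h : SplitsCode C E a) {M : Fin N → Fin m → Matrix s s ℂ}
    (hm : ∀ _J : Fin N, Nonempty (Fin m)) {X : Fin N → Fin m → Finset κ}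
    {f : Fin N → Fin m → κ → ℂ}
    (hX : ∀ J i i', i ≠ i' → Disjoint (X J i) (X J i'))
    (hM : ∀ J i, M J i = ∑ k ∈ X J i, f J i k • E k) {Ψ : EuclideanSpace ℂ s} (hΨ : Ψ ∈ C)
    (hΨ1 : ‖Ψ‖ = 1) : IsSolution M Ψ (discriminator C E) := by
  classical
  have hact (B : Matrix s s ℂ) (J : Fin N) (i : Fin m)
      (hB : ∀ k ∈ X J i, B * (E k * projMatrix C) = 0) : jointProb (M J i) B Ψ = 0 := by
    have : act B (act (M J i) Ψ) = 0 := by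
      rw [hM, act_sum, act_vec_sum]
      refine Finset.sum_eq_zero fun k hk => ?_
      have := congrArg (fun A => act A Ψ) (hB k hk)
      simp only [act_mul, act_projMatrix_of_mem hΨ, act_zero_left] at this
      rw [act_smul, act_vec_smul, this, smul_zero]
    rw [jointProb, this, inner_zero_right]
  -- Disjointness leaves at most one `i` with `k ∈ X J i`. The default guess covers `none` and
  -- indices in no `X J i`, outcomes of probability zero.
  refine ⟨hΨ1, h.isPOVM_discriminator, fun o J => if hi : ∃ i, ∃ k ∈ X J i, o = some k then hi.choose
    else (hm J).some, fun J i o ho => hact _ J i fun k hk => ?_⟩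
  rcases o with _ | k'
  · rw [h.discriminator_none, h.rest_mul_act]
  · rw [h.discriminator_some, h.branch_mul_act, if_neg]
    rintro rfl
    have hi : ∃ i, ∃ k ∈ X J i, some k' = some k := ⟨i, k', hk, rfl⟩
    simp only [dif_pos hi] at ho
    obtain ⟨k, hk1, hk2⟩ := hi.choose_spec
    rw [Option.some.injEq] at hk2
    subst hk2
    exact Finset.disjoint_left.1 (hX J _ _ ho) hk1 hk

end Code

/-! ### Operators on one tensor factor and GHZ states -/

section Tensor

variable {d n : ℕ}

lemma tensorOp_mul (A B : Fin n → Matrix (Fin d) (Fin d) ℂ) :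
    tensorOp A * tensorOp B = tensorOp (fun u => A u * B u) := by
  ext x y
  simp only [tensorOp, Matrix.mul_apply, Matrix.of_apply, ← Finset.prod_mul_distrib]
  rw [Finset.prod_univ_sum, Fintype.piFinset_univ]

lemma tensorOp_one : tensorOp (fun _ : Fin n => (1 : Matrix (Fin d) (Fin d) ℂ)) = 1 := by
  ext x y
  simp only [tensorOp, Matrix.of_apply, Matrix.one_apply, Finset.prod_ite_zero,
    Finset.prod_const_one, Finset.mem_univ, true_imp_iff, funext_iff]

lemma conjTranspose_tensorOp (A : Fin n → Matrix (Fin d) (Fin d) ℂ) :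
    (tensorOp A).conjTranspose = tensorOp fun u => (A u).conjTranspose := by
  ext x y
  simp [tensorOp]

lemma act_tensorOp (A : Fin n → Matrix (Fin d) (Fin d) ℂ)
    (v : Fin n → EuclideanSpace ℂ (Fin d)) :
    act (tensorOp A) (tensorVec v) = tensorVec fun u => act (A u) (v u) := by
  ext x
  simp only [act_apply, tensorOp, tensorVec, Matrix.of_apply, ← Finset.prod_mul_distrib]
  rw [Finset.prod_univ_sum, Fintype.piFinset_univ]

lemma inner_tensorVec (v w : Fin n → EuclideanSpace ℂ (Fin d)) :
    inner ℂ (tensorVec v) (tensorVec w) = ∏ u, inner ℂ (v u) (w u) := by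
  simp only [PiLp.inner_apply, tensorVec, RCLike.inner_apply, map_prod, ← Finset.prod_mul_distrib]
  rw [Finset.prod_univ_sum, Fintype.piFinset_univ]

lemma onFactor_apply (l : Fin n) (A : Matrix (Fin d) (Fin d) ℂ) (x y : Fin n → Fin d) :
    onFactor l A x y = A (x l) (y l) *
      ∏ u ∈ Finset.univ.erase l, (1 : Matrix (Fin d) (Fin d) ℂ) (x u) (y u) := by
  rw [onFactor, tensorOp, Matrix.of_apply, ← Finset.mul_prod_erase _ _ (Finset.mem_univ l),
    Function.update_self]
  congr 1
  exact Finset.prod_congr rfl fun u hu => by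
    rw [Function.update_of_ne (Finset.ne_of_mem_erase hu)]

lemma onFactor_mul (l : Fin n) (A B : Matrix (Fin d) (Fin d) ℂ) :
    onFactor l (A * B) = onFactor l A * onFactor l B := by
  rw [onFactor, onFactor, onFactor, tensorOp_mul]
  congr 1
  ext1 u
  obtain rfl | h := eq_or_ne u l
  · simp
  · simp [Function.update_of_ne h]

lemma conjTranspose_onFactor (l : Fin n) (A : Matrix (Fin d) (Fin d) ℂ) :
    (onFactor l A).conjTranspose = onFactor l A.conjTranspose := by
  rw [onFactor, onFactor, conjTranspose_tensorOp]
  congr 1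
  ext1 u
  obtain rfl | h := eq_or_ne u l
  · simp
  · simp [Function.update_of_ne h]

lemma onFactor_one (l : Fin n) : onFactor l (1 : Matrix (Fin d) (Fin d) ℂ) = 1 := by
  rw [onFactor, Function.update_eq_self_iff.2 rfl, tensorOp_one]

/-- `onFactor` as a linear map in the operator. -/
def onFactorLin (d : ℕ) (l : Fin n) :
    Matrix (Fin d) (Fin d) ℂ →ₗ[ℂ] Matrix (Fin n → Fin d) (Fin n → Fin d) ℂ where
  toFun := onFactor l
  map_add' A B := by ext x y; simp [onFactor_apply, add_mul]
  map_smul' c A := by ext x y; simp [onFactor_apply, mul_assoc]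

open scoped MatrixOrder Matrix.Norms.L2Operator in
-- The defect `1 - ∑ L_k† L_k` is some `B† B`, and `onFactor` is linear and respects `1`, products
-- and adjoints.
lemma isError_onFactor {κ : Type*} [Fintype κ] (l : Fin n) {L : κ → Matrix (Fin d) (Fin d) ℂ}
    (hL : IsError L) : IsError fun k => onFactor l (L k) := by
  obtain ⟨B, hB⟩ := CStarAlgebra.nonneg_iff_eq_star_mul_self.1 hL.nonneg
  rw [Matrix.star_eq_conjTranspose] at hB
  have e : 1 - ∑ k, (onFactor l (L k)).conjTranspose * onFactor l (L k) =
      (onFactor l B).conjTranspose * onFactor l B := by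
    simp only [conjTranspose_onFactor, ← onFactor_mul]
    rw [← hB, ← onFactor_one l]
    change onFactorLin d l 1 - ∑ k, onFactorLin d l _ = onFactorLin d l _
    rw [← map_sum, ← map_sub]
  rw [IsError, e]
  exact Matrix.posSemidef_conjTranspose_mul_self _

lemma inner_onFactor_tensorVec (l : Fin n) (A B : Matrix (Fin d) (Fin d) ℂ)
    (v w : Fin n → EuclideanSpace ℂ (Fin d)) :
    inner ℂ (act (onFactor l A) (tensorVec v)) (act (onFactor l B) (tensorVec w)) =
      inner ℂ (act A (v l)) (act B (w l)) *
        ∏ u ∈ Finset.univ.erase l, inner ℂ (v u) (w u) := by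
  rw [onFactor, onFactor, act_tensorOp, act_tensorOp, inner_tensorVec,
    ← Finset.mul_prod_erase _ _ (Finset.mem_univ l), Function.update_self, Function.update_self]
  congr 1
  refine Finset.prod_congr rfl fun u hu => ?_
  rw [Function.update_of_ne (Finset.ne_of_mem_erase hu),
    Function.update_of_ne (Finset.ne_of_mem_erase hu), act_one, act_one]

variable (η : Fin d → ℝ)
  (φ : OrthonormalBasis (Fin d) ℂ (EuclideanSpace ℂ (Fin d)))

lemma inner_onFactor_ghzState (l : Fin n) (A B : Matrix (Fin d) (Fin d) ℂ) (i i' : Fin n → Fin d) :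
    inner ℂ (act (onFactor l A) (ghzState η φ i)) (act (onFactor l B) (ghzState η φ i')) =
      ∑ j, ∑ j', (η j * η j' : ℂ) * (inner ℂ (act A (φ (j + i l))) (act B (φ (j' + i' l))) *
        if ∀ u ∈ Finset.univ.erase l, j + i u = j' + i' u then 1 else 0) := by
  simp only [ghzState, act_vec_sum, act_vec_smul, sum_inner]
  refine Finset.sum_congr rfl fun j _ => ?_
  rw [inner_sum]
  refine Finset.sum_congr rfl fun j' _ => ?_
  rw [inner_smul_left, inner_smul_right, inner_onFactor_tensorVec, Complex.conj_ofReal]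
  simp only [orthonormal_iff_ite.1 φ.orthonormal, Finset.prod_ite_zero, Finset.prod_const_one,
    mul_assoc]

/-- Any factor `u ≠ l` forces `j' = j`. Reindexing by the shift `i l`, which preserves `η`, leaves
the bipartite inner product. -/
lemma inner_onFactor_ghzState_self [NeZero d] (hn : 2 ≤ n) (l : Fin n) (A B : Matrix (Fin d) (Fin d) ℂ)
    {i : Fin n → Fin d} (hi : ∀ j, η (j + i l) = η j) :
    inner ℂ (act (onFactor l A) (ghzState η φ i)) (act (onFactor l B) (ghzState η φ i)) =
      ∑ j, (η j ^ 2 : ℂ) * inner ℂ (act A (φ j)) (act B (φ j)) := by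
  have : Nontrivial (Fin n) := Fin.nontrivial_iff_two_le.2 hn
  obtain ⟨u, hu⟩ := exists_ne l
  rw [inner_onFactor_ghzState,
    ← Equiv.sum_comp (Equiv.addRight (i l)) fun j => (η j ^ 2 : ℂ) * inner ℂ (act A (φ j)) (act B (φ j))]
  refine Finset.sum_congr rfl fun j _ => ?_
  rw [Finset.sum_eq_single j]
  · simp [hi, sq]
  · intro j' _ hj'
    rw [if_neg, mul_zero, mul_zero]
    exact fun h => hj' (add_right_cancel (h u (by simpa using hu))).symm
  · simp

/-- Factor `u` forces `j = j'`, which factor `v` then contradicts. -/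
lemma inner_onFactor_ghzState_eq_zero [NeZero d] {l u v : Fin n} (hu : u ≠ l) (hv : v ≠ l)
    (A B : Matrix (Fin d) (Fin d) ℂ) {i i' : Fin n → Fin d} (hiu : i u = i' u) (hiv : i v ≠ i' v) :
    inner ℂ (act (onFactor l A) (ghzState η φ i)) (act (onFactor l B) (ghzState η φ i')) = 0 := by
  rw [inner_onFactor_ghzState]
  refine Finset.sum_eq_zero fun j _ => Finset.sum_eq_zero fun j' _ => ?_
  rw [if_neg, mul_zero, mul_zero]
  intro h
  have h1 := h u (by simpa using hu)
  have h2 := h v (by simpa using hv)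
  rw [hiu] at h1
  rw [add_right_cancel h1] at h2
  exact hiv (add_left_cancel h2)

end Tensor

/-! ### Operators as vectors through the Schmidt state -/

section Schmidt

variable {d : ℕ} (η : Fin d → ℝ) (ψ φ : OrthonormalBasis (Fin d) ℂ (EuclideanSpace ℂ (Fin d)))

lemma act_onKing_schmidtState (A : Matrix (Fin d) (Fin d) ℂ) :
    act (onKing A) (schmidtState η ψ φ) =
      ∑ j, (η j : ℂ) • WithLp.toLp 2 (fun x : Fin d × Fin d => ψ j x.1 * act A (φ j) x.2) := by
  rw [schmidtState, act_vec_sum]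
  refine Finset.sum_congr rfl fun j _ => ?_
  rw [act_vec_smul]
  congr 1
  ext ⟨x, y⟩
  simp only [act_apply, onKing, Fintype.sum_prod_type, Matrix.kroneckerMap_apply, Matrix.one_apply]
  simp [Finset.mul_sum, mul_left_comm]

lemma inner_onKing_schmidtState (A B : Matrix (Fin d) (Fin d) ℂ) :
    inner ℂ (act (onKing A) (schmidtState η ψ φ)) (act (onKing B) (schmidtState η ψ φ)) =
      ∑ j, (η j ^ 2 : ℂ) * inner ℂ (act A (φ j)) (act B (φ j)) := by
  have key (v w v' w' : EuclideanSpace ℂ (Fin d)) :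
      inner ℂ (WithLp.toLp 2 (fun x : Fin d × Fin d => v x.1 * w x.2))
        (WithLp.toLp 2 (fun x : Fin d × Fin d => v' x.1 * w' x.2)) =
        (inner ℂ v v' * inner ℂ w w' : ℂ) := by
    simp only [PiLp.inner_apply, RCLike.inner_apply, map_mul, Fintype.sum_prod_type,
      Finset.sum_mul_sum]
    exact Finset.sum_congr rfl fun _ _ => Finset.sum_congr rfl fun _ _ => by ring
  simp only [act_onKing_schmidtState, sum_inner, inner_sum, inner_smul_left,
    inner_smul_right, key, Complex.conj_ofReal, orthonormal_iff_ite.1 ψ.orthonormal]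
  refine Finset.sum_congr rfl fun j _ => ?_
  simp [sq, mul_assoc]

/-- The linear map `A ↦ (1 ⊗ A) Ψ`, `Ψ` the bipartite Schmidt state. -/
noncomputable def steer : Matrix (Fin d) (Fin d) ℂ →ₗ[ℂ] EuclideanSpace ℂ (Fin d × Fin d) where
  toFun A := act (onKing A) (schmidtState η ψ φ)
  map_add' A B := by
    simp only [onKing, Matrix.kronecker_add, act, map_add, LinearMap.add_apply]
  map_smul' c A := by
    simp only [onKing, Matrix.kronecker_smul, act, map_smul, LinearMap.smul_apply, RingHom.id_apply]

lemma steer_apply (A : Matrix (Fin d) (Fin d) ℂ) :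
    steer η ψ φ A = act (onKing A) (schmidtState η ψ φ) := rfl

variable {η}

/-- The squared norm of the image is `∑ j, η j ^ 2 * ‖A φ_j‖ ^ 2` with positive weights, so `A`
vanishes on a basis if the image is zero. -/
lemma steer_injective (hη : ∀ j, 0 < η j) : Function.Injective (steer η ψ φ) := by
  rw [injective_iff_map_eq_zero]
  intro A hA
  have h := inner_onKing_schmidtState η ψ φ A A
  rw [← steer_apply, hA, inner_zero_left] at h
  simp only [inner_self_eq_norm_sq_to_K] at h
  have h' : ∑ j, η j ^ 2 * ‖act A (φ j)‖ ^ 2 = 0 := by 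
    refine Complex.ofReal_injective (Eq.trans ?_ h.symm)
    push_cast
    rfl
  rw [Finset.sum_eq_zero_iff_of_nonneg fun j _ => by positivity] at h'
  have hφ (j : Fin d) : act A (φ j) = 0 := by
    have := h' j (Finset.mem_univ j)
    have hj := (hη j).ne'
    simpa [hj] using this
  refine act_ext fun v => ?_
  rw [← φ.sum_repr v, act_vec_sum]
  simp [act_vec_smul, hφ, act_zero_left]

/-- `steer` as a linear equivalence. -/
noncomputable def steerEquiv (hη : ∀ j, 0 < η j) :
    Matrix (Fin d) (Fin d) ℂ ≃ₗ[ℂ] EuclideanSpace ℂ (Fin d × Fin d) :=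
  LinearEquiv.ofInjectiveOfFinrankEq (steer η ψ φ) (steer_injective ψ φ hη)
    (by simp [Module.finrank_matrix])

lemma steerEquiv_apply (hη : ∀ j, 0 < η j) (A : Matrix (Fin d) (Fin d) ℂ) :
    steerEquiv ψ φ hη A = act (onKing A) (schmidtState η ψ φ) := rfl

end Schmidt

lemma exists_isError_smul {s κ : Type*} [Fintype s] [DecidableEq s] [Fintype κ]
    (T : κ → Matrix s s ℂ) : ∃ c : ℝ, 0 < c ∧ IsError fun k => (c : ℂ) • T k := by
  set A : Matrix s s ℂ := ∑ k, (T k).conjTranspose * T k with hA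
  have hAh : A.IsHermitian := by
    simp [hA, Matrix.IsHermitian, Matrix.conjTranspose_sum]
  set F : EuclideanSpace ℂ s →L[ℂ] EuclideanSpace ℂ s :=
    LinearMap.toContinuousLinearMap (Matrix.toEuclideanLin A) with hF
  -- The summand `1` keeps `b` positive when `F = 0`.
  set b : ℝ := ‖F‖ + 1 with hb
  have hb0 : 0 < b := by positivity
  refine ⟨√b⁻¹, Real.sqrt_pos.2 (inv_pos.2 hb0), ?_⟩
  have e : ∑ k, (((√b⁻¹ : ℝ) : ℂ) • T k).conjTranspose * (((√b⁻¹ : ℝ) : ℂ) • T k) =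
      ((b⁻¹ : ℝ) : ℂ) • A := by
    rw [hA, Finset.smul_sum]
    refine Finset.sum_congr rfl fun k _ => ?_
    rw [Matrix.conjTranspose_smul, Matrix.smul_mul, Matrix.mul_smul, smul_smul, RCLike.star_def,
      Complex.conj_ofReal, ← Complex.ofReal_mul, Real.mul_self_sqrt (inv_nonneg.2 hb0.le)]
  rw [IsError, e, ← Matrix.isPositive_toEuclideanLin_iff]
  refine ⟨Matrix.isSymmetric_toEuclideanLin_iff.2 ?_, fun x => ?_⟩
  · simp [Matrix.IsHermitian, Matrix.conjTranspose_smul, hAh.eq]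
  · change 0 ≤ RCLike.re (inner ℂ (act (1 - ((b⁻¹ : ℝ) : ℂ) • A) x) x)
    rw [act_sub, act_one, act_smul, inner_sub_left, inner_smul_left, Complex.conj_ofReal, map_sub,
      inner_self_eq_norm_sq]
    have h1 : RCLike.re (inner ℂ (act A x) x) ≤ ‖F‖ * ‖x‖ ^ 2 := by
      calc RCLike.re (inner ℂ (act A x) x) ≤ ‖act A x‖ * ‖x‖ := re_inner_le_norm _ _
        _ ≤ (‖F‖ * ‖x‖) * ‖x‖ := by gcongr; exact F.le_opNorm x
        _ = _ := by ring
    have h2 : RCLike.re (((b⁻¹ : ℝ) : ℂ) * inner ℂ (act A x) x) =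
        b⁻¹ * RCLike.re (inner ℂ (act A x) x) := RCLike.re_ofReal_mul _ _
    rw [h2, sub_nonneg, inv_mul_le_iff₀ hb0]
    nlinarith [sq_nonneg ‖x‖]

/-! ### From the bipartite solution to the code -/

section King

variable {d N m : ℕ} {M : Fin N → Fin m → Matrix (Fin d) (Fin d) ℂ}
  {ψ φ : OrthonormalBasis (Fin d) ℂ (EuclideanSpace ℂ (Fin d))} {η : Fin d → ℝ}

lemma jointProb_ketbra {s : Type*} [Fintype s] [DecidableEq s] (A : Matrix s s ℂ)
    (v Ψ : EuclideanSpace ℂ s) :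
    jointProb A (ketbra v) Ψ = inner ℂ (act A Ψ) v * inner ℂ v (act A Ψ) := by
  have (w : EuclideanSpace ℂ s) : act (ketbra v) w = inner ℂ v w • v := by
    ext x
    simp only [act_apply, ketbra, Matrix.of_apply, PiLp.smul_apply, PiLp.inner_apply,
      RCLike.inner_apply, smul_eq_mul, Finset.sum_mul, RCLike.star_def]
    exact Finset.sum_congr rfl fun _ _ => by ring
  rw [jointProb, this, inner_smul_right, mul_comm]

lemma exists_isKingError (hd : 0 < d) (hη : ∀ j, 0 < η j)
    (p : OrthonormalBasis (Fin (d ^ 2)) ℂ (EuclideanSpace ℂ (Fin d × Fin d)))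
    (hsol : IsSolution (fun J i => onKing (M J i)) (schmidtState η ψ φ) (fun k => ketbra (p k))) :
    ∃ L X f α, IsKingError M (schmidtState η ψ φ) L X f α := by
  obtain ⟨-, -, guess, hguess⟩ := hsol
  set e := steerEquiv ψ φ hη with he
  obtain ⟨c, hc, hL⟩ := exists_isError_smul fun k => e.symm (p k)
  have hc' : (c : ℂ) ≠ 0 := by exact_mod_cast hc.ne'
  have hd' : (d : ℝ) ≠ 0 := by exact_mod_cast hd.ne'
  -- The image of `L k` is `c • p k`, of squared norm `c ^ 2`, hence `α = c ^ 2 * d`.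
  refine ⟨fun k => (c : ℂ) • e.symm (p k), fun J i => Finset.univ.filter fun k => guess k J = i,
    fun J i k => (c : ℂ)⁻¹ * inner ℂ (p k) (e (M J i)), c ^ 2 * d, hL, ?_, ?_, by positivity, ?_⟩
  · intro J i i' hi
    rw [Finset.disjoint_left]
    intro k hk hk'
    simp only [Finset.mem_filter] at hk hk'
    exact hi (hk.2.symm.trans hk'.2)
  · intro J i
    apply e.injective
    simp only [map_sum, map_smul, LinearEquiv.apply_symm_apply, smul_smul]
    conv_lhs => rw [← p.sum_repr' (e (M J i))]
    rw [Finset.sum_filter]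
    refine Finset.sum_congr rfl fun k _ => ?_
    split_ifs with hk
    · congr 1
      field_simp
    · have := hguess J i k hk
      rw [jointProb_ketbra, ← steerEquiv_apply ψ φ hη, ← he] at this
      have h0 : inner ℂ (p k) (e (M J i)) = 0 :=
        (mul_eq_zero.1 this).elim inner_eq_zero_symm.1 id
      rw [h0, zero_smul]
  · intro k k'
    rw [← steerEquiv_apply ψ φ hη, ← steerEquiv_apply ψ φ hη, ← he]
    simp only [map_smul, LinearEquiv.apply_symm_apply, inner_smul_left, inner_smul_right,
      Complex.conj_ofReal, orthonormal_iff_ite.1 p.orthonormal]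
    split_ifs
    · push_cast
      have : (d : ℂ) ≠ 0 := by exact_mod_cast hd'
      field_simp
    · simp

variable {L : Fin (d ^ 2) → Matrix (Fin d) (Fin d) ℂ} {X : Fin N → Fin m → Finset (Fin (d ^ 2))}
  {f : Fin N → Fin m → Fin (d ^ 2) → ℂ} {α : ℝ}

/-- The images of the `L k` are orthogonal and nonzero, so the `L k` are `d ^ 2` independent
elements of a space of dimension `d ^ 2`. -/
lemma IsKingError.exists_eq_sum (h : IsKingError M (schmidtState η ψ φ) L X f α) (hd : 0 < d)
    (A : Matrix (Fin d) (Fin d) ℂ) : ∃ c : Fin (d ^ 2) → ℂ, ∑ k, c k • L k = A := by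
  have hα := h.alpha_pos
  have hli : LinearIndependent ℂ fun k => steer η ψ φ (L k) := by
    refine linearIndependent_of_ne_zero_of_inner_eq_zero (fun k hk => ?_) fun k k' hk => ?_
    · have := h.orthogonal k k
      rw [← steer_apply, hk, inner_zero_left, if_pos rfl, eq_comm, Complex.ofReal_eq_zero] at this
      exact (div_pos hα (by exact_mod_cast hd)).ne' this
    · exact (h.orthogonal k k').trans (if_neg hk)
  have hL : LinearIndependent ℂ L := LinearIndependent.of_comp (steer η ψ φ) hli
  have := hL.span_eq_top_of_card_eq_finrank' (by simp [Module.finrank_matrix, sq])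
  exact (Submodule.mem_span_range_iff_exists_fun ℂ).1 (this ▸ Submodule.mem_top)

variable {n : ℕ} {l : Fin n} {S : Finset (EuclideanSpace ℂ (Fin n → Fin d))}

/-- The identity is a combination of the `L k`, so the admissibility relations include plain
orthogonality. -/
lemma IsGHZFamily.inner_onFactor_of_ne (hS : IsGHZFamily l η φ L S)
    (h : IsKingError M (schmidtState η ψ φ) L X f α) (hd : 0 < d)
    {Φ Φ' : EuclideanSpace ℂ (Fin n → Fin d)} (hΦ : Φ ∈ S) (hΦ' : Φ' ∈ S) (hne : Φ ≠ Φ') :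
    inner ℂ Φ Φ' = 0 := by
  obtain ⟨c, hc⟩ := h.exists_eq_sum hd 1
  have h1 : ∑ k, c k • onFactor l (L k) = 1 := by
    have := congrArg (onFactorLin d l) hc
    simp only [map_sum, map_smul] at this
    exact this.trans (onFactor_one l)
  rw [← act_one Φ, ← act_one Φ', ← h1, act_sum, act_sum]
  simp only [act_smul, sum_inner, inner_sum, inner_smul_left, inner_smul_right,
    hS.2 Φ hΦ Φ' hΦ' hne, mul_zero, Finset.sum_const_zero]

lemma norm_ghzState [NeZero d] (hn : 2 ≤ n) (hη_sum : ∑ j, η j ^ 2 = 1) {i : Fin n → Fin d}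
    (hi : ∀ j, η (j + i l) = η j) : ‖ghzState η φ i‖ = 1 := by
  have h := inner_onFactor_ghzState_self η φ hn l 1 1 hi
  simp only [onFactor_one, act_one, orthonormal_iff_ite.1 φ.orthonormal, if_true, mul_one] at h
  rw [inner_self_eq_norm_sq_to_K] at h
  have h2 : ‖ghzState η φ i‖ ^ 2 = 1 := by
    rw [← hη_sum]
    refine Complex.ofReal_injective (Eq.trans ?_ (h.trans ?_)) <;> simp
  exact (pow_eq_one_iff_of_nonneg (norm_nonneg _) two_ne_zero).1 h2

lemma IsGHZFamily.orthonormal [NeZero d] (hS : IsGHZFamily l η φ L S)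
    (h : IsKingError M (schmidtState η ψ φ) L X f α) (hn : 2 ≤ n) (hη_sum : ∑ j, η j ^ 2 = 1) :
    Orthonormal ℂ (Subtype.val : S → EuclideanSpace ℂ (Fin n → Fin d)) := by
  refine ⟨fun Φ => ?_, fun Φ Φ' hne => ?_⟩
  · obtain ⟨i, hi, hΦ⟩ := hS.1 Φ Φ.2
    rw [hΦ, norm_ghzState hn hη_sum hi]
  · exact hS.inner_onFactor_of_ne h (NeZero.pos d) Φ.2 Φ'.2 fun h' => hne (Subtype.ext h')

lemma IsGHZFamily.finrank_code [NeZero d] (hS : IsGHZFamily l η φ L S)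
    (h : IsKingError M (schmidtState η ψ φ) L X f α) (hn : 2 ≤ n) (hη_sum : ∑ j, η j ^ 2 = 1) :
    Module.finrank ℂ (code S) = S.card :=
  finrank_span_finset_eq_card (hS.orthonormal h hn hη_sum).linearIndependent

/-- Both sides are sesquilinear, so the generators suffice: equal ones reduce to the bipartite
relation, distinct ones to admissibility. -/
lemma IsGHZFamily.splitsCode [NeZero d] (hS : IsGHZFamily l η φ L S)
    (h : IsKingError M (schmidtState η ψ φ) L X f α) (hn : 2 ≤ n) (hη_sum : ∑ j, η j ^ 2 = 1) :
    SplitsCode (code S) (fun k => onFactor l (L k)) (α / d) := by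
  refine ⟨div_pos h.alpha_pos (by exact_mod_cast NeZero.pos d), fun k k' x hx y hy => ?_⟩
  suffices H : inner ℂ (act (onFactor l (L k)) x) (act (onFactor l (L k')) y) =
      (if k = k' then ((α / d : ℝ) : ℂ) else 0) * inner ℂ x y by
    rw [H, ite_mul, zero_mul]
  induction hx, hy using Submodule.span_induction₂ with
  | mem_mem Φ Φ' hΦ hΦ' =>
    obtain rfl | hne := eq_or_ne Φ Φ'
    · obtain ⟨i, hi, rfl⟩ := hS.1 Φ hΦ
      rw [inner_onFactor_ghzState_self η φ hn l _ _ hi, ← inner_onKing_schmidtState η ψ φ,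
        h.orthogonal, inner_self_eq_norm_sq_to_K, norm_ghzState hn hη_sum hi]
      simp
    · rw [hS.2 Φ hΦ Φ' hΦ' hne, hS.inner_onFactor_of_ne h (NeZero.pos d) hΦ hΦ' hne, mul_zero]
  | zero_left y hy => simp [act_vec_zero]
  | zero_right x hx => simp [act_vec_zero]
  | add_left x y z _ _ _ h1 h2 =>
    simp only [act, map_add, inner_add_left, mul_add] at h1 h2 ⊢
    rw [h1, h2]
  | add_right x y z _ _ _ h1 h2 =>
    simp only [act, map_add, inner_add_right, mul_add] at h1 h2 ⊢
    rw [h1, h2]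
  | smul_left r x y _ _ h1 =>
    rw [act_vec_smul, inner_smul_left, inner_smul_left, h1, mul_left_comm]
  | smul_right r x y _ _ h1 =>
    rw [act_vec_smul, inner_smul_right, inner_smul_right, h1, mul_left_comm]

lemma exists_isGHZFamily [NeZero d] (hd : 2 ≤ d) (hn : 3 ≤ n) (hη_sum : ∑ j, η j ^ 2 = 1)
    (l : Fin n) (L : Fin (d ^ 2) → Matrix (Fin d) (Fin d) ℂ) :
    ∃ S : Finset (EuclideanSpace ℂ (Fin n → Fin d)), IsGHZFamily l η φ L S ∧ 2 ≤ S.card := by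
  classical
  obtain ⟨u, hul, v, hvl, huv⟩ : ∃ u, u ≠ l ∧ ∃ v, v ≠ l ∧ u ≠ v := by
    have hc : 1 < (Finset.univ.erase l).card := by
      rw [Finset.card_erase_of_mem (Finset.mem_univ l), Finset.card_univ, Fintype.card_fin]
      omega
    obtain ⟨u, hu, v, hv, huv⟩ := Finset.one_lt_card.1 hc
    exact ⟨u, Finset.ne_of_mem_erase hu, v, Finset.ne_of_mem_erase hv, huv⟩
  have : Nontrivial (Fin d) := Fin.nontrivial_iff_two_le.2 hd
  obtain ⟨t, ht⟩ := exists_ne (0 : Fin d)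
  -- Only factor `v` is shifted: `i' l = 0` needs no symmetry of `η`, and factor `u` agrees with the
  -- unshifted state.
  set i' : Fin n → Fin d := Function.update 0 v t with hi'
  have hi'l (j : Fin d) : η (j + i' l) = η j := by simp [hi', Function.update_of_ne hvl.symm]
  have hu : (0 : Fin n → Fin d) u = i' u := by simp [hi', Function.update_of_ne huv]
  have hv : (0 : Fin n → Fin d) v ≠ i' v := by simp [hi', ht.symm]
  have h0 (A B : Matrix (Fin d) (Fin d) ℂ) := inner_onFactor_ghzState_eq_zero η φ hul hvl A B hu hv
  have h0' (A B : Matrix (Fin d) (Fin d) ℂ) :=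
    inner_onFactor_ghzState_eq_zero η φ hul hvl A B hu.symm hv.symm
  have hne : ghzState η φ (0 : Fin n → Fin d) ≠ ghzState η φ i' := by
    intro he
    have h1 := h0 1 1
    rw [onFactor_one, act_one, act_one, he, inner_self_eq_zero, ← norm_eq_zero,
      norm_ghzState (by omega) hη_sum hi'l] at h1
    exact one_ne_zero h1
  refine ⟨{ghzState η φ 0, ghzState η φ i'}, ⟨?_, ?_⟩, (Finset.card_pair hne).ge⟩
  · simp only [Finset.mem_insert, Finset.mem_singleton]
    rintro _ (rfl | rfl)
    · exact ⟨0, by simp, rfl⟩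
    · exact ⟨i', hi'l, rfl⟩
  · simp only [Finset.mem_insert, Finset.mem_singleton]
    rintro _ (rfl | rfl) _ (rfl | rfl) hΦ k k'
    · exact absurd rfl hΦ
    · exact h0 _ _
    · exact h0' _ _
    · exact absurd rfl hΦ

end King

end MeanKing

theorem mainTheorem3 (d n N m : ℕ) [NeZero d] (hd : 2 ≤ d) (hn : 3 ≤ n)
    (M : Fin N → Fin m → Matrix (Fin d) (Fin d) ℂ) (hM : ∀ J, MeanKing.IsMeasurement (M J))
    (ψ φ : OrthonormalBasis (Fin d) ℂ (EuclideanSpace ℂ (Fin d)))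
    (η : Fin d → ℝ) (hη : ∀ j, 0 < η j) (hη_sum : ∑ j, η j ^ 2 = 1)
    (p : OrthonormalBasis (Fin (d ^ 2)) ℂ (EuclideanSpace ℂ (Fin d × Fin d)))
    (hsol : MeanKing.IsSolution (fun J i => MeanKing.onKing (M J i))
      (MeanKing.schmidtState η ψ φ) (fun k => MeanKing.ketbra (p k)))
    (l : Fin n) :
    (∃ L X f α, MeanKing.IsKingError M (MeanKing.schmidtState η ψ φ) L X f α) ∧
    ∀ L X f α, MeanKing.IsKingError M (MeanKing.schmidtState η ψ φ) L X f α →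
      (∃ S : Finset (EuclideanSpace ℂ (Fin n → Fin d)),
        MeanKing.IsGHZFamily l η φ L S ∧ 2 ≤ S.card) ∧
      ∀ S : Finset (EuclideanSpace ℂ (Fin n → Fin d)), MeanKing.IsGHZFamily l η φ L S →
        MeanKing.IsQECC (d ^ n) S.card (MeanKing.code S)
          (fun k => MeanKing.onFactor l (L k)) ∧
        ∀ Ψ ∈ MeanKing.code S, ‖Ψ‖ = 1 →
          MeanKing.IsSolution (fun J i => MeanKing.onFactor l (M J i)) Ψ
            (MeanKing.discriminator (MeanKing.code S) (fun k => MeanKing.onFactor l (L k))) := by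
  refine ⟨MeanKing.exists_isKingError (NeZero.pos d) hη p hsol, fun L X f α h =>
    ⟨MeanKing.exists_isGHZFamily hd hn hη_sum l L, fun S hS => ?_⟩⟩
  have hsplit := hS.splitsCode h (by omega) hη_sum
  have : Nonempty (Fin (d ^ 2)) := ⟨⟨0, pow_pos (NeZero.pos d) 2⟩⟩
  constructor
  · have := hsplit.isQECC (MeanKing.isError_onFactor l h.isError)
    rwa [hS.finrank_code h (by omega) hη_sum, Fintype.card_fun, Fintype.card_fin,
      Fintype.card_fin] at this
  · intro Ψ hΨ hΨ1
    -- The bipartite guess is used only to exhibit some element of `Fin m` for each `J`, as a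
    -- default.
    obtain ⟨-, -, guess, -⟩ := hsol
    refine hsplit.isSolution (fun J => ⟨guess (Classical.arbitrary _) J⟩) h.disjoint
      (f := f) (fun J i => ?_) hΨ hΨ1
    rw [h.decomposition J i]
    exact (map_sum (MeanKing.onFactorLin d l) _ _).trans
      (Finset.sum_congr rfl fun k _ => map_smul (MeanKing.onFactorLin d l) _ _)
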